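/- Assume the Continuum Hypothesis. Let $K,L,M$ be countably infinite sets such that $K,L,M,\omega_1$ are pairwise disjoint, and let $\{K_n\}_{n\in\omega}$ and $\{L_n\}_{n\in\omega}$ be partitions of $K$ and $L$, respectively, into infinite pieces. For a set $S$ let $[S]^\omega$ be the family of all countably infinite subsets of $S$, and put $$\mathcal K=\{A\in[K]^\omega:\ A\cap K_n\text{ is finite for every }n\},\quad \mathcal L=\{A\in[L]^\omega:\ A\cap L_n\text{ is finite for every }n\},\quad \mathcal M=[M]^\omega .$$ For a subset $A$ of a topological space $X$ let $\mathrm{acc}(A)$ be the set of all points $x\in X$ such that $U\cap A$ is infinite for every open $U\ni x$. A set $A\in[X]^\omega$ is called convergent if there is $x\in X$ such that $A\setminus U$ is finite for every open $U\ni x$. A space is called $0$-dimensional if its clopen sets form a base. Then there is a $0$-dimensional $T_2$ topology on $X=K\cup L\cup M\cup\omega_1$ such that: (a) for every nonempty open set $U$, $|U\cap\omega_1|=\omega_1$, $|U\cap M|=\omega$, and $|U\cap K_n|=|U\cap L_n|=\omega$ for all but finitely many $n$; (b) every $A\in\mathcal K$ has a convergent infinite subset; (c) if $A\in[X]^\omega$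 is convergent, then $A\setminus K$ is finite and $A\cap K\in\mathcal K$; (d) if $B\in\mathcal K\cup\mathcal L$, then $\emptyset\ne\mathrm{acc}(B)\subseteq\omega_1$; (e) if $B\in\mathcal M$, then $\mathrm{acc}(B)\cap\omega_1\ne\emptyset$; (f) $\mathrm{acc}(K_n)=\mathrm{acc}(L_n)=\mathrm{acc}(\Gamma)=\emptyset$ for every $n\in\omega$ and every $\Gamma\in[\omega_1]^\omega$. -/

import Mathlib

open Set Filter Topology
open scoped Cardinal Ordinal

universe u v w

/-- The disjoint union `K ∪ L ∪ M ∪ ω₁`, where `ω₁` is the set of all countable ordinals. -/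
inductive Pt (K : Type u) (L : Type v) (M : Type w) : Type (max u v w 1)
  | ofK : K → Pt K L M
  | ofL : L → Pt K L M
  | ofM : M → Pt K L M
  | ofOrd : Iio (ω₁ : Ordinal.{0}) → Pt K L M

namespace Pt

variable {K : Type u} {L : Type v} {M : Type w}

/-- A subset of `K`, regarded as a subset of `K ∪ L ∪ M ∪ ω₁`. -/
def inK (L : Type v) (M : Type w) (A : Set K) : Set (Pt K L M) := Pt.ofK '' A

/-- A subset of `L`, regarded as a subset of `K ∪ L ∪ M ∪ ω₁`. -/
def inL (K : Type u) (M : Type w) (A : Set L) : Set (Pt K L M) := Pt.ofL '' A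

/-- The part `K` of `K ∪ L ∪ M ∪ ω₁`. -/
def partK (K : Type u) (L : Type v) (M : Type w) : Set (Pt K L M) := range Pt.ofK

/-- The part `M` of `K ∪ L ∪ M ∪ ω₁`. -/
def partM (K : Type u) (L : Type v) (M : Type w) : Set (Pt K L M) := range Pt.ofM

/-- The part `ω₁` of `K ∪ L ∪ M ∪ ω₁`. -/
def partOrd (K : Type u) (L : Type v) (M : Type w) : Set (Pt K L M) := range Pt.ofOrd

end Pt

/-- `P 0, P 1, …` is a partition of the type `S` into infinite pieces. -/
def IsInfinitePartition {S : Type*} (P : ℕ → Set S) : Prop :=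
  (∀ n, (P n).Infinite) ∧ Pairwise (fun m n => Disjoint (P m) (P n)) ∧ (⋃ n, P n) = Set.univ

/-- The infinite subsets of `⋃ n, P n` that meet every `P n` in a finite set. -/
def smallTraces {X : Type*} (P : ℕ → Set X) : Set (Set X) :=
  {A | A.Infinite ∧ A ⊆ (⋃ n, P n) ∧ ∀ n, (A ∩ P n).Finite}

/-- `[S]^ω`: the countably infinite subsets of `S`. -/
def ctblInfSubsets {X : Type*} (S : Set X) : Set (Set X) :=
  {A | A ⊆ S ∧ A.Countable ∧ A.Infinite}

/-- The points every open neighbourhood of which meets `A` in infinitely many points. -/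
def accPts {X : Type*} [TopologicalSpace X] (A : Set X) : Set X :=
  {x | ∀ U : Set X, IsOpen U → x ∈ U → (U ∩ A).Infinite}

/-- The set `A` converges to some point: every open neighbourhood of that point contains all but
finitely many points of `A`. (Used for countably infinite `A` only, where it says that the
one-to-one enumerations of `A` converge.) -/
def SetConverges {X : Type*} [TopologicalSpace X] (A : Set X) : Prop :=
  ∃ x : X, ∀ U : Set X, IsOpen U → x ∈ U → (A \ U).Finite

/-- The clopen sets form a base of the topology. -/
def IsZeroDimensional (X : Type*) [TopologicalSpace X] : Prop :=
  TopologicalSpace.IsTopologicalBasis {U : Set X | IsClopen U}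

/-! The topology is induced by a map of `X` into `2^ω₁`. On the countable set `Z = K ∪ L ∪ M` one
builds two-valued functions `f γ`, `γ < ω₁`, together with their values at the ordinals. By CH there
are only `ω₁` tasks (separate a point from a set `A`, treat a set `C`), so they can be listed with
each occurring cofinally, while only countably many objects exist before any stage.

Call a set light if it meets every `K_n` and `L_n` in a finite set. Stage `α` creates the point `α`
(`exists_new_point`). If `C` is an infinite light subset of `K` almost disjoint from all earlier `S
β`, the values at `α` form a limit pattern of `C`, and a pseudo-intersection `S α ⊆ C` will converge
to `α`. If `C` is light and disjoint from `K`, then `B α = C`, which, if infinite, will accumulate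
at `α`. The stage also creates `f α` (`exists_new_clopen`). It respects the values at the points `β
≤ α` and separates the given point from `A`. It splits the infinite traces on old cylinders of `M`
and of all pieces almost disjoint from `A`, and `C` too unless `A` and finitely many `S β` almost
cover it.

The `S β` thus meet every infinite light subset of `K` in an infinite set, which gives (b) and half
of (d); the `B β` give the rest of the nonemptiness in (d), and (e). Splitting makes nonempty open
sets large on `M` and on almost all pieces; new limits of transversals then supply uncountably many
ordinals. A convergent set cannot be split, so its part in `Z` is almost covered by finitely many `S
β`: this is (c). Separation gives (f), the Hausdorff property and the inclusion in (d). -/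

/-! ### Recursion and splitting of countable families -/

/-- Well-founded recursion with an invariant that only looks at the values up to the current stage. -/
theorem exists_of_forall_exists_update {I δ : Type*} [LinearOrder I] [WellFoundedLT I] [Inhabited δ]
    (P : I → (I → δ) → Prop)
    (hP : ∀ a g g', (∀ b ≤ a, g b = g' b) → P a g → P a g')
    (step : ∀ a g, (∀ b < a, P b g) → ∃ d, P a (Function.update g a d)) :
    ∃ g, ∀ a, P a g := by
  classical
  let ext (a : I) (p : (b : I) → b < a → δ) : I → δ := fun b => if h : b < a then p b h else default
  let nxt (a : I) (p : (b : I) → b < a → δ) : δ :=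
    if h : ∃ d, P a (Function.update (ext a p) a d) then h.choose else default
  let g : I → δ := WellFoundedLT.fix nxt
  have hg (a : I) : g a = nxt a (fun b _ => g b) := WellFoundedLT.fix_eq nxt a
  refine ⟨g, fun a => ?_⟩
  induction a using WellFoundedLT.induction with
  | ind a ih =>
    have hext (b : I) (hb : b < a) : ext a (fun b _ => g b) b = g b := by simp [ext, hb]
    have hex : ∃ d, P a (Function.update (ext a (fun b _ => g b)) a d) := by
      refine step a _ fun b hb => hP b g _ (fun c hc => (hext c (hc.trans_lt hb)).symm) (ih b hb)
    have hga : g a = hex.choose := by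
      rw [hg a]
      simp only [nxt]
      rw [dif_pos hex]
    refine hP a _ g (fun b hb => ?_) hex.choose_spec
    rcases hb.eq_or_lt with rfl | hb
    · rw [Function.update_self, hga]
    · rw [Function.update_of_ne hb.ne, hext b hb]

/-- A sequence of infinite sets has an injective choice function. -/
theorem exists_injective_forall_mem {Z : Type*} (D : ℕ → Set Z) (hD : ∀ n, (D n).Infinite) :
    ∃ z : ℕ → Z, Function.Injective z ∧ ∀ n, z n ∈ D n := by
  have : Nonempty Z := (hD 0).nonempty.to_type
  inhabit Z
  obtain ⟨z, hz⟩ := exists_of_forall_exists_update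
    (fun n (z : ℕ → Z) => z n ∈ D n ∧ ∀ m < n, z m ≠ z n)
    (fun n z z' h hz => by
      refine ⟨h n le_rfl ▸ hz.1, fun m hm => ?_⟩
      rw [← h n le_rfl, ← h m hm.le]
      exact hz.2 m hm)
    (fun n z _ => by
      obtain ⟨d, hd, hd'⟩ := (hD n).exists_notMem_finite ((Set.finite_Iio n).image z)
      refine ⟨d, by simpa using hd, fun m hm => ?_⟩
      rw [Function.update_self, Function.update_of_ne hm.ne]
      exact fun h => hd' ⟨m, hm, h⟩)
  refine ⟨z, fun m n h => ?_, fun n => (hz n).1⟩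
  rcases lt_trichotomy m n with hmn | hmn | hmn
  · exact absurd h ((hz n).2 m hmn)
  · exact hmn
  · exact absurd h.symm ((hz m).2 n hmn)

/-- A two-valued function with prescribed values almost everywhere on each `S j`, splitting every
member of a countable family that is not almost covered by finitely many `S j`. -/
theorem exists_splitting {Z J : Type*} [Countable J] (S : J → Set Z) (r : J → Bool)
    (hS : ∀ i j, r i ≠ r j → (S i ∩ S j).Finite) (𝒟 : Set (Set Z)) (h𝒟 : 𝒟.Countable) :
    ∃ f : Z → Bool, (∀ j, {z ∈ S j | f z ≠ r j}.Finite) ∧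
      ∀ D ∈ 𝒟, (∀ G : Finset J, (D \ ⋃ j ∈ G, S j).Infinite) →
        ∀ b, {z ∈ D | f z = b}.Infinite := by
  classical
  obtain ⟨e, he⟩ := exists_injective_nat J
  let 𝒟' : Set (Set Z) := {D ∈ 𝒟 | ∀ G : Finset J, (D \ ⋃ j ∈ G, S j).Infinite}
  have hfin (n : ℕ) : {j | e j < n}.Finite := (Set.finite_Iio n).preimage he.injOn
  -- default values off the splitting points
  let f₀ : Z → Bool := fun z =>
    if h : ∃ n, ∃ j, e j = n ∧ z ∈ S j then r (Nat.find_spec h).choose else true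
  have hf₀ (j : J) : {z ∈ S j | f₀ z ≠ r j}.Finite := by
    -- A wrong value on `S j` comes from an earlier `S i` with `r i ≠ r j`; there are finitely many
    -- such `i`, each meeting `S j` finitely.
    refine ((hfin (e j)).biUnion (t := fun i => if r i ≠ r j then S i ∩ S j else ∅) ?_).subset ?_
    · intro i _
      split_ifs with h
      exacts [hS i j h, Set.finite_empty]
    · rintro z ⟨hz, hne⟩
      have h : ∃ n, ∃ j, e j = n ∧ z ∈ S j := ⟨_, j, rfl, hz⟩
      have hval : f₀ z = r (Nat.find_spec h).choose := by simp only [f₀]; rw [dif_pos h]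
      have hs := (Nat.find_spec h).choose_spec
      set i := (Nat.find_spec h).choose
      have hle : e i ≤ e j := hs.1 ▸ Nat.find_min' h ⟨j, rfl, hz⟩
      rw [hval] at hne
      have hij : e i ≠ e j := fun h => hne (by rw [he h])
      refine Set.mem_biUnion (x := i) (lt_of_le_of_ne hle hij) ?_
      rw [if_pos hne]
      exact ⟨hs.2, hz⟩
  rcases 𝒟'.eq_empty_or_nonempty with h0 | h0
  · refine ⟨f₀, hf₀, fun D hD hG => ?_⟩
    exact absurd (show D ∈ 𝒟' from ⟨hD, hG⟩) (by simp [h0])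
  have : Countable 𝒟' := (h𝒟.mono (Set.sep_subset _ _)).to_subtype
  have : Nonempty 𝒟' := h0.to_subtype
  -- Every pair `(D, b)` is visited infinitely often. The `k`-th point avoids all `S j` with `e j <
  -- k`, so each `S j` receives finitely many of these points.
  obtain ⟨t, ht⟩ := exists_surjective_nat (𝒟' × Bool × ℕ)
  obtain ⟨z, hzinj, hz⟩ := exists_injective_forall_mem
    (fun k => ((t k).1 : Set Z) \ ⋃ j ∈ (hfin k).toFinset, S j) (fun k => (t k).1.2.2 _)
  let f : Z → Bool := fun y => if h : ∃ k, z k = y then (t h.choose).2.1 else f₀ y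
  have hf (k : ℕ) : f (z k) = (t k).2.1 := by
    have h : ∃ k', z k' = z k := ⟨k, rfl⟩
    have : h.choose = k := hzinj h.choose_spec
    simp only [f]
    rw [dif_pos h, this]
  refine ⟨f, fun j => ?_, fun D hD hG b => ?_⟩
  · refine ((hf₀ j).union ((Set.finite_Iic (e j)).image z)).subset ?_
    rintro y ⟨hy, hne⟩
    by_cases h : ∃ k, z k = y
    · right
      obtain ⟨k, rfl⟩ := h
      refine ⟨k, ?_, rfl⟩
      by_contra hk
      refine (hz k).2 (Set.mem_biUnion (x := j) ?_ hy)
      simpa using hk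
    · left
      refine ⟨hy, ?_⟩
      simpa only [f, dif_neg h] using hne
  · choose k hk using fun i : ℕ => ht (⟨D, hD, hG⟩, b, i)
    refine Set.infinite_of_injective_forall_mem (f := fun i => z (k i)) ?_ ?_
    · intro i i' h
      have h := hzinj h
      have := (hk i).symm.trans ((congrArg t h).trans (hk i'))
      simpa using this
    · intro i
      refine ⟨?_, ?_⟩
      · have := (hz (k i)).1
        rwa [hk i] at this
      · rw [hf, hk i]

/-! ### Cylinders and limit patterns -/

/-- The points at which finitely many two-valued functions have prescribed values. -/
def cyl {Z I : Type*} (f : I → Z → Bool) (E : Finset I) (ε : I → Bool) : Set Z :=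
  {z | ∀ γ ∈ E, f γ z = ε γ}

theorem cyl_empty {Z I : Type*} (f : I → Z → Bool) (ε : I → Bool) : cyl f ∅ ε = univ := by
  simp [cyl]

theorem cyl_insert {Z I : Type*} [DecidableEq I] (f : I → Z → Bool) (E : Finset I) (ε : I → Bool)
    (γ : I) (Y : Set Z) :
    Y ∩ cyl f (insert γ E) ε = {z ∈ Y ∩ cyl f E ε | f γ z = ε γ} := by
  ext z
  simp only [cyl, Finset.mem_insert, forall_eq_or_imp, Set.mem_inter_iff, Set.mem_ofPred_eq]
  tauto

theorem cyl_congr {Z I : Type*} {f f' : I → Z → Bool} {E : Finset I} {ε ε' : I → Bool}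
    (hf : ∀ γ ∈ E, f γ = f' γ) (hε : ∀ γ ∈ E, ε γ = ε' γ) : cyl f E ε = cyl f' E ε' := by
  ext z
  exact forall₂_congr fun γ hγ => by rw [hf γ hγ, hε γ hγ]

/-- An infinite set has a limit pattern: a choice of values for which every finite part is taken
infinitely often on the set. -/
theorem exists_forall_inter_cyl_infinite {Z I : Type*} (f : I → Z → Bool) {C : Set Z}
    (hC : C.Infinite) : ∃ c : I → Bool, ∀ E : Finset I, (C ∩ cyl f E c).Infinite := by
  classical
  -- An ultrafilter containing `C` and no finite set decides every `f γ`; its decisions are the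
  -- pattern.
  have : NeBot (cofinite ⊓ 𝓟 C) := by
    rwa [← frequently_mem_iff_neBot, frequently_cofinite_mem_iff_infinite]
  let 𝒰 : Ultrafilter Z := Ultrafilter.of (cofinite ⊓ 𝓟 C)
  have h𝒰 : (𝒰 : Filter Z) ≤ cofinite ⊓ 𝓟 C := Ultrafilter.of_le _
  have hc (γ : I) : {z | f γ z = decide ({z | f γ z = true} ∈ 𝒰)} ∈ 𝒰 := by
    by_cases h : {z | f γ z = true} ∈ 𝒰
    · simp [h]
    · have h' := Ultrafilter.compl_mem_iff_notMem.2 h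
      simp only [h, decide_false]
      convert h' using 1
      ext z
      simp
  refine ⟨fun γ => decide ({z | f γ z = true} ∈ 𝒰), fun E hfin => ?_⟩
  have h1 : cyl f E (fun γ => decide ({z | f γ z = true} ∈ 𝒰)) ∈ (𝒰 : Filter Z) := by
    have : cyl f E (fun γ => decide ({z | f γ z = true} ∈ 𝒰)) =
        ⋂ γ ∈ E, {z | f γ z = decide ({z | f γ z = true} ∈ 𝒰)} := by
      ext z; simp [cyl]
    rw [this]
    exact (Filter.biInter_finset_mem E).2 fun γ _ => hc γ
  have h2 : C ∈ (𝒰 : Filter Z) := h𝒰 (mem_inf_of_right (mem_principal_self C))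
  have h3 : (C ∩ cyl f E (fun γ => decide ({z | f γ z = true} ∈ 𝒰)))ᶜ ∈ (𝒰 : Filter Z) :=
    h𝒰 (mem_inf_of_left hfin.compl_mem_cofinite)
  exact 𝒰.neBot.ne (Filter.empty_mem_iff_bot.1 (by
    have := Filter.inter_mem (Filter.inter_mem h2 h1) h3
    simp at this))

/-- A pseudo-intersection for countably many two-valued functions. -/
theorem exists_infinite_subset_eventually_eq {Z I : Type*} (f : I → Z → Bool) {C : Set Z}
    {c : I → Bool} (hc : ∀ E : Finset I, (C ∩ cyl f E c).Infinite) {Γ : Set I}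
    (hΓ : Γ.Countable) :
    ∃ S ⊆ C, S.Infinite ∧ ∀ γ ∈ Γ, {z ∈ S | f γ z ≠ c γ}.Finite := by
  classical
  have : Countable Γ := hΓ.to_subtype
  obtain ⟨e, he⟩ := exists_injective_nat Γ
  have hfin (n : ℕ) : {j | e j ≤ n}.Finite := (Set.finite_Iic n).preimage he.injOn
  obtain ⟨z, hzinj, hz⟩ := exists_injective_forall_mem
    (fun k => C ∩ cyl f ((hfin k).toFinset.image (↑)) c) (fun k => hc _)
  refine ⟨range z, ?_, infinite_range_of_injective hzinj, fun γ hγ => ?_⟩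
  · rintro _ ⟨k, rfl⟩
    exact (hz k).1
  · refine ((Set.finite_Iio (e ⟨γ, hγ⟩)).image z).subset ?_
    rintro _ ⟨⟨k, rfl⟩, hne⟩
    refine ⟨k, ?_, rfl⟩
    by_contra hk
    refine hne ((hz k).2 γ ?_)
    simp only [Finset.mem_image, Set.Finite.mem_toFinset, Set.mem_ofPred_eq]
    exact ⟨⟨γ, hγ⟩, not_lt.1 hk, rfl⟩

/-! ### The transfinite construction -/

section Construction

variable {Z I : Type*} [LinearOrder I]

/-- The set meets all the pieces `P n` and `Q n` in finite sets. -/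
def IsLight (P Q : ℕ → Set Z) (Y : Set Z) : Prop :=
  ∀ n, (Y ∩ P n).Finite ∧ (Y ∩ Q n).Finite

/-- The point `x` may be separated from the set `A` by a clopen set. -/
def Separable (P Q : ℕ → Set Z) (M : Set Z) (x : Z ⊕ I) (A : Set Z) : Prop :=
  -- A set `P n ∪ Q n` is almost disjoint from the light sets attached to an ordinal, so any point
  -- may avoid it. Another `A` may contain almost all of some `S β`, hence is separated from points
  -- of `Z` only; finiteness of `A ∩ M` leaves `M` free to be split.
  (∃ n, A = P n ∪ Q n) ∨ (IsLight P Q A ∧ (A ∩ M).Finite ∧ ∃ z, x = Sum.inl z)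

open Classical in
/-- The value at the point `β` of the clopen set number `γ`: for `β ≤ γ` it tells whether `β` is
the point to be separated at stage `γ`, and later points take a prescribed value. -/
noncomputable def ordVal (x : I → Z ⊕ I) (c : I → I → Bool) (γ β : I) : Bool :=
  -- At most one `β ≤ γ` gets the value false; this makes countable sets of ordinals closed and
  -- discrete.
  if β ≤ γ then decide (x γ ≠ Sum.inr β) else c β γ

theorem ordVal_of_le {x : I → Z ⊕ I} {c : I → I → Bool} {γ β : I} (h : β ≤ γ) :
    ordVal x c γ β = true ↔ x γ ≠ Sum.inr β := by
  simp [ordVal, h]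

theorem ordVal_of_lt {x : I → Z ⊕ I} {c : I → I → Bool} {γ β : I} (h : γ < β) :
    ordVal x c γ β = c β γ := by
  simp [ordVal, h]

/-- What is achieved at stage `α`, where `x α` is to be separated from `A α`, and `C α` is
to be split and to be given an accumulation point. -/
structure StageOK (P Q : ℕ → Set Z) (M : Set Z) (x : I → Z ⊕ I) (A C : I → Set Z)
    (f : I → Z → Bool) (c : I → I → Bool) (S B : I → Set Z) (α : I) : Prop where
  S_sub : S α ⊆ ⋃ n, P n
  S_light : IsLight P Q (S α)
  S_inter : ∀ β < α, (S α ∩ S β).Finite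
  -- Old clopen sets at the new point, and next the new clopen set at all points so far: together
  -- they yield convergence of `S β` to `β`.
  S_col : ∀ γ < α, {z ∈ S α | f γ z ≠ ordVal x c γ α}.Finite
  S_row : ∀ β ≤ α, {z ∈ S β | f α z ≠ ordVal x c α β}.Finite
  B_disj : Disjoint (B α) (⋃ n, P n)
  B_light : IsLight P Q (B α)
  B_col : (B α).Infinite → ∀ E : Finset I, (∀ γ ∈ E, γ < α) →
    (B α ∩ cyl f E fun γ => ordVal x c γ α).Infinite
  B_row : ∀ β ≤ α, ∀ E : Finset I, (∀ γ ∈ E, γ < α) →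
    (B β ∩ cyl f E fun γ => ordVal x c γ β).Infinite →
    {z ∈ B β ∩ cyl f E fun γ => ordVal x c γ β | f α z = ordVal x c α β}.Infinite
  split : ∀ Y, (Y = M ∨ ∃ n, Y = P n ∨ Y = Q n) → (Y ∩ A α).Finite →
    ∀ E : Finset I, (∀ γ ∈ E, γ < α) → ∀ ε : I → Bool, (Y ∩ cyl f E ε).Infinite →
    ∀ b, {z ∈ Y ∩ cyl f E ε | f α z = b}.Infinite
  sep_false : ∀ z, x α = Sum.inl z → f α z = false
  sep_true : ∀ z ∈ A α, x α ≠ Sum.inl z → f α z = true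
  split_task : (∀ G : Finset I, (∀ β ∈ G, β ≤ α) → (C α \ (A α ∪ ⋃ β ∈ G, S β)).Infinite) →
    ∀ b, {z ∈ C α | f α z = b}.Infinite
  hit : (C α).Infinite → IsLight P Q (C α) → C α ⊆ ⋃ n, P n → ∃ β ≤ α, (C α ∩ S β).Infinite
  B_eq : IsLight P Q (C α) → Disjoint (C α) (⋃ n, P n) → B α = C α

/-- The locality required by the recursion: the bounds on `E` and `G` ensure that stage `α` involves
no later choices. -/
theorem StageOK.congr {P Q : ℕ → Set Z} {M : Set Z} {x : I → Z ⊕ I} {A C : I → Set Z}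
    {f f' : I → Z → Bool} {c c' : I → I → Bool} {S S' B B' : I → Set Z} {α : I}
    (hf : ∀ β ≤ α, f β = f' β) (hc : ∀ β ≤ α, c β = c' β) (hS : ∀ β ≤ α, S β = S' β)
    (hB : ∀ β ≤ α, B β = B' β) (h : StageOK P Q M x A C f c S B α) :
    StageOK P Q M x A C f' c' S' B' α := by
  have hv (γ β : I) (hβ : β ≤ α) : ordVal x c' γ β = ordVal x c γ β := by
    simp [ordVal, hc β hβ]
  have hcyl (E : Finset I) (hE : ∀ γ ∈ E, γ < α) (ε : I → Bool) : cyl f' E ε = cyl f E ε :=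
    cyl_congr (fun γ hγ => (hf γ (hE γ hγ).le).symm) (fun _ _ => rfl)
  have hα := le_refl α
  constructor
  · rw [← hS α hα]; exact h.S_sub
  · rw [← hS α hα]; exact h.S_light
  · intro β hβ; rw [← hS α hα, ← hS β hβ.le]; exact h.S_inter β hβ
  · intro γ hγ; rw [← hS α hα, hv γ α hα, ← hf γ hγ.le]; exact h.S_col γ hγ
  · intro β hβ; rw [← hS β hβ, hv α β hβ, ← hf α hα]; exact h.S_row β hβ
  · rw [← hB α hα]; exact h.B_disj
  · rw [← hB α hα]; exact h.B_light
  · intro hinf E hE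
    simp only [hv _ _ hα]
    rw [← hB α hα] at hinf ⊢
    rw [hcyl E hE]
    exact h.B_col hinf E hE
  · intro β hβ E hE
    simp only [hv _ _ hβ]
    rw [← hB β hβ, hcyl E hE, ← hf α hα]
    exact h.B_row β hβ E hE
  · intro Y hY hYA E hE ε
    rw [hcyl E hE, ← hf α hα]
    exact h.split Y hY hYA E hE ε
  · rw [← hf α hα]; exact h.sep_false
  · rw [← hf α hα]; exact h.sep_true
  · intro hG
    rw [← hf α hα]
    refine h.split_task fun G hGα => ?_
    have : ⋃ β ∈ G, S β = ⋃ β ∈ G, S' β := iUnion₂_congr fun β hβ => hS β (hGα β hβ)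
    rw [this]
    exact hG G hGα
  · intro h1 h2 h3
    obtain ⟨β, hβ, h4⟩ := h.hit h1 h2 h3
    exact ⟨β, hβ, hS β hβ ▸ h4⟩
  · rw [← hB α hα]; exact h.B_eq

theorem IsLight.mono {P Q : ℕ → Set Z} {Y Y' : Set Z} (h : IsLight P Q Y) (hY : Y' ⊆ Y) :
    IsLight P Q Y' := fun n =>
  ⟨(h n).1.subset (inter_subset_inter_left _ hY), (h n).2.subset (inter_subset_inter_left _ hY)⟩

theorem isLight_empty {P Q : ℕ → Set Z} : IsLight P Q ∅ := fun n => by simp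

/-- The choice of the new point. -/
theorem exists_new_point {P Q : ℕ → Set Z} {α : I} (hα : (Iio α).Countable) (C : Set Z)
    (f : I → Z → Bool) (S : I → Set Z) :
    ∃ (c : I → Bool) (S₀ B₀ : Set Z), S₀ ⊆ (⋃ n, P n) ∧ IsLight P Q S₀ ∧
      (∀ β < α, (S₀ ∩ S β).Finite) ∧ (∀ γ < α, {z ∈ S₀ | f γ z ≠ c γ}.Finite) ∧
      Disjoint B₀ (⋃ n, P n) ∧ IsLight P Q B₀ ∧
      (B₀.Infinite → ∀ E : Finset I, (B₀ ∩ cyl f E c).Infinite) ∧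
      (C.Infinite → IsLight P Q C → C ⊆ (⋃ n, P n) →
        (∃ β < α, (C ∩ S β).Infinite) ∨ (C ∩ S₀).Infinite) ∧
      (IsLight P Q C → Disjoint C (⋃ n, P n) → B₀ = C) := by
  -- Only an infinite light `C ⊆ ⋃ n, P n` not yet hit, or a light `C` off `⋃ n, P n`, calls for
  -- action; otherwise `S₀` and `B₀` are empty.
  by_cases h1 : C.Infinite ∧ IsLight P Q C ∧ C ⊆ (⋃ n, P n) ∧ ∀ β < α, (C ∩ S β).Finite
  · obtain ⟨hC, hl, hP, hS⟩ := h1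
    obtain ⟨c, hc⟩ := exists_forall_inter_cyl_infinite f hC
    obtain ⟨S₀, hSC, hS₀, hfin⟩ := exists_infinite_subset_eventually_eq f hc hα
    refine ⟨c, S₀, ∅, hSC.trans hP, hl.mono hSC,
      fun β hβ => (hS β hβ).subset (inter_subset_inter_left _ hSC), hfin, by simp, isLight_empty,
      fun h => absurd h (by simp), fun _ _ _ => Or.inr ?_, fun _ hd => ?_⟩
    · rwa [inter_eq_right.2 hSC]
    · exact absurd (hd.eq_bot_of_le hP) hC.nonempty.ne_empty
  · have key : C.Infinite → IsLight P Q C → C ⊆ (⋃ n, P n) →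
        (∃ β < α, (C ∩ S β).Infinite) ∨ (C ∩ (∅ : Set Z)).Infinite := by
      intro hC hl hP
      by_contra! h
      exact h1 ⟨hC, hl, hP, fun β hβ => h.1 β hβ⟩
    by_cases h2 : IsLight P Q C ∧ Disjoint C (⋃ n, P n)
    · obtain ⟨hl, hd⟩ := h2
      have : ∃ c : I → Bool, C.Infinite → ∀ E : Finset I, (C ∩ cyl f E c).Infinite := by
        by_cases hC : C.Infinite
        · obtain ⟨c, hc⟩ := exists_forall_inter_cyl_infinite f hC
          exact ⟨c, fun _ => hc⟩
        · exact ⟨fun _ => true, fun h => absurd h hC⟩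
      obtain ⟨c, hc⟩ := this
      exact ⟨c, ∅, C, by simp, isLight_empty, by simp, by simp, hd, hl, hc, key, fun _ _ => rfl⟩
    · exact ⟨fun _ => true, ∅, ∅, by simp, isLight_empty, by simp, by simp, by simp, isLight_empty,
        fun h => absurd h (by simp), key, fun h h' => absurd ⟨h, h'⟩ h2⟩

/-- The choice of the new clopen set, when the points up to `α` are known. -/
theorem exists_new_clopen {P Q : ℕ → Set Z} {M : Set Z} (hPM : Disjoint (⋃ n, P n) M) {α : I} (hα : (Iic α).Countable)
    (x : Z ⊕ I) (A C : Set Z) (hxA : Separable P Q M x A)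
    (f : I → Z → Bool) (v : I → I → Bool) (r : I → Bool) (hr : ∀ β, r β = true ↔ x ≠ Sum.inr β)
    (S B : I → Set Z)
    (hS : ∀ β ≤ α, S β ⊆ ⋃ n, P n) (hSl : ∀ β ≤ α, IsLight P Q (S β))
    (hSi : ∀ β ≤ α, ∀ γ ≤ α, β ≠ γ → (S β ∩ S γ).Finite)
    (hB : ∀ β ≤ α, Disjoint (B β) (⋃ n, P n)) (hBl : ∀ β ≤ α, IsLight P Q (B β)) :
    ∃ f₀ : Z → Bool, (∀ β ≤ α, {z ∈ S β | f₀ z ≠ r β}.Finite) ∧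
      (∀ β ≤ α, ∀ E : Finset I, (∀ γ ∈ E, γ < α) → (B β ∩ cyl f E fun γ => v γ β).Infinite →
        {z ∈ B β ∩ cyl f E fun γ => v γ β | f₀ z = r β}.Infinite) ∧
      (∀ Y, (Y = M ∨ ∃ n, Y = P n ∨ Y = Q n) → (Y ∩ A).Finite →
        ∀ E : Finset I, (∀ γ ∈ E, γ < α) → ∀ ε : I → Bool, (Y ∩ cyl f E ε).Infinite →
        ∀ b, {z ∈ Y ∩ cyl f E ε | f₀ z = b}.Infinite) ∧
      (∀ z, x = Sum.inl z → f₀ z = false) ∧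
      (∀ z ∈ A, x ≠ Sum.inl z → f₀ z = true) ∧
      ((∀ G : Finset I, (∀ β ∈ G, β ≤ α) → (C \ (A ∪ ⋃ β ∈ G, S β)).Infinite) →
        ∀ b, {z ∈ C | f₀ z = b}.Infinite) := by
  classical
  have : Countable (Iic α) := hα.to_subtype
  have hlt : (Iio α).Countable := hα.mono Iio_subset_Iic_self
  have : Countable (Iio α) := hlt.to_subtype
  -- The constraints on the new function: `none` asks for true on `A`, and `β` for `r β` on `S β`.
  -- They conflict with `A` only if `x` is the ordinal `β`, and then `A = P n ∪ Q n` while `S β` is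
  -- light.
  let T : Option (Iic α) → Set Z := fun j => j.elim A fun β => S β
  let s : Option (Iic α) → Bool := fun j => j.elim true fun β => r β
  -- the countable family to be split
  let cyls : Set (Set Z) := {D | ∃ (E : Finset I) (ε : I → Bool), (∀ γ ∈ E, γ < α) ∧ D = cyl f E ε}
  have hcyls : cyls.Countable := by
    refine (countable_range fun q : Finset (Iio α × Bool) =>
      {z | ∀ p ∈ q, f p.1 z = p.2}).mono ?_
    rintro D ⟨E, ε, hE, rfl⟩
    refine ⟨E.attach.image fun γ => (⟨γ.1, hE γ.1 γ.2⟩, ε γ.1), ?_⟩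
    ext z
    simp only [cyl, Set.mem_ofPred_eq, Finset.mem_image, Finset.mem_attach, true_and,
      forall_exists_index]
    constructor
    · exact fun h γ hγ => h _ ⟨γ, hγ⟩ rfl
    · rintro h _ γ rfl
      exact h γ γ.2
  let pieces : Set (Set Z) := {M} ∪ range P ∪ range Q ∪ B '' Iic α
  have hpieces : pieces.Countable :=
    (((countable_singleton M).union (countable_range P)).union (countable_range Q)).union
      (hα.image B)
  let 𝒟 : Set (Set Z) := insert C (image2 (· ∩ ·) pieces cyls)
  have h𝒟 : 𝒟.Countable := (hpieces.image2 hcyls _).insert C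
  have hSA (β : I) (hβ : β ≤ α) (hx : x = Sum.inr β) : (S β ∩ A).Finite := by
    rcases hxA with ⟨n, rfl⟩ | ⟨-, -, z, hz⟩
    · rw [inter_union_distrib_left]
      exact (hSl β hβ n).1.union (hSl β hβ n).2
    · simp [hz] at hx
  have hBA (β : I) (hβ : β ≤ α) (hx : x = Sum.inr β) : (B β ∩ A).Finite := by
    rcases hxA with ⟨n, rfl⟩ | ⟨-, -, z, hz⟩
    · rw [inter_union_distrib_left]
      exact (hBl β hβ n).1.union (hBl β hβ n).2
    · simp [hz] at hx
  have hr' (β : I) (h : r β ≠ true) : x = Sum.inr β := by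
    by_contra h'
    exact h ((hr β).2 h')
  have hT (i j : Option (Iic α)) (hij : s i ≠ s j) : (T i ∩ T j).Finite := by
    match i, j with
    | none, none => exact absurd rfl hij
    | none, some β =>
      rw [inter_comm]
      exact hSA β β.2 (hr' β hij.symm)
    | some β, none => exact hSA β β.2 (hr' β hij)
    | some β, some γ =>
      refine hSi β β.2 γ γ.2 fun h => hij ?_
      rw [Subtype.ext h]
  obtain ⟨f₁, hf₁, hsplit₁⟩ := exists_splitting T s hT 𝒟 h𝒟
  -- A finite correction of `f₁` turns "almost everywhere on `A`" into "everywhere", except at `x`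
  -- itself.
  let f₀ : Z → Bool := fun z => if x = Sum.inl z then false else if z ∈ A then true else f₁ z
  have hne : {z | f₀ z ≠ f₁ z}.Finite := by
    have h1 : {z | x = Sum.inl z}.Finite :=
      Set.Subsingleton.finite fun y hy z hz => Sum.inl_injective (hy.symm.trans hz)
    refine (h1.union (hf₁ none)).subset fun z hz => ?_
    by_cases hx : x = Sum.inl z
    · exact Or.inl hx
    · right
      by_cases hzA : z ∈ A
      · refine ⟨hzA, fun h => hz ?_⟩
        simp only [f₀, if_neg hx, if_pos hzA]
        exact h.symm
      · exact absurd (by simp only [f₀, if_neg hx, if_neg hzA]) hz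
  have hinf (D : Set Z) (b : Bool) (h : {z ∈ D | f₁ z = b}.Infinite) :
      {z ∈ D | f₀ z = b}.Infinite := by
    refine (h.sdiff hne).mono ?_
    rintro z ⟨⟨hz, hb⟩, hz'⟩
    exact ⟨hz, (not_not.1 hz').trans hb⟩
  have hsplit (D : Set Z) (hD : D ∈ 𝒟)
      (hG : ∀ G : Finset I, (∀ β ∈ G, β ≤ α) → (D \ (A ∪ ⋃ β ∈ G, S β)).Infinite) (b : Bool) :
      {z ∈ D | f₀ z = b}.Infinite := by
    refine hinf D b (hsplit₁ D hD (fun G => ?_) b)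
    refine (hG (G.eraseNone.image (↑)) ?_).mono (sdiff_subset_sdiff_right ?_)
    · intro β hβ
      obtain ⟨β, -, rfl⟩ := Finset.mem_image.1 hβ
      exact β.2
    · refine iUnion₂_subset fun j hj => ?_
      match j with
      | none => exact subset_union_left
      | some β =>
        refine Subset.trans ?_ subset_union_right
        refine subset_biUnion_of_mem (u := S) (x := (β : I)) ?_
        exact Finset.mem_coe.2 (Finset.mem_image.2 ⟨β, Finset.mem_eraseNone.2 hj, rfl⟩)
  have htrue (z : Z) (hz : z ∈ A) (hx : x ≠ Sum.inl z) : f₀ z = true := by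
    simp only [f₀, if_neg hx, if_pos hz]
  -- a set almost disjoint from `A` and from all the `S β` is split
  have hsplit' (D : Set Z) (hD : D ∈ 𝒟) (hDA : (D \ A).Infinite)
      (hDS : ∀ β ≤ α, (D ∩ S β).Finite) (b : Bool) : {z ∈ D | f₀ z = b}.Infinite := by
    refine hsplit D hD (fun G hGα => ?_) b
    have : (D ∩ ⋃ β ∈ G, S β).Finite := by
      rw [inter_iUnion₂]
      exact G.finite_toSet.biUnion fun β hβ => hDS β (hGα β hβ)
    refine (hDA.sdiff this).mono ?_
    rintro z ⟨⟨hz, hzA⟩, hz'⟩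
    exact ⟨hz, fun h => h.elim hzA fun h => hz' ⟨hz, h⟩⟩
  refine ⟨f₀, fun β hβ => ?_, fun β hβ E hE hi => ?_, fun Y hY hYA E hE ε hi b => ?_, fun z hz => ?_,
    htrue, hsplit C (mem_insert _ _)⟩
  · refine ((hf₁ (some ⟨β, hβ⟩)).union hne).subset ?_
    rintro z ⟨hz, hz'⟩
    by_cases h : f₀ z = f₁ z
    · exact Or.inl ⟨hz, h ▸ hz'⟩
    · exact Or.inr h
  -- If the trace is not almost inside `A`, it is split, since `B β` is disjoint from all `S γ`.
  -- Otherwise `f₀` is true on almost all of it, and `r β` is true because `x = Sum.inr β` would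
  -- make `B β ∩ A` finite.
  · by_cases hDA : ((B β ∩ cyl f E fun γ => v γ β) \ A).Infinite
    · refine hsplit' _ (Or.inr ⟨B β, Or.inr ⟨β, hβ, rfl⟩, _, ⟨E, _, hE, rfl⟩, rfl⟩) hDA ?_ _
      intro γ hγ
      convert Set.finite_empty
      refine disjoint_iff_inter_eq_empty.1 ?_
      exact ((hB β hβ).mono_right (hS γ hγ)).mono_left inter_subset_left
    · have hi' : ((B β ∩ cyl f E fun γ => v γ β) ∩ A).Infinite := by
        intro h
        refine hi ((h.union (not_infinite.1 hDA)).subset ?_)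
        rw [inter_union_sdiff]
      have hrβ : r β = true := by
        by_contra h
        exact hi' ((hBA β hβ (hr' β h)).subset (inter_subset_inter_left _ inter_subset_left))
      have h1 : {z | x = Sum.inl z}.Finite :=
        Set.Subsingleton.finite fun y hy z hz => Sum.inl_injective (hy.symm.trans hz)
      refine (hi'.sdiff h1).mono ?_
      rintro z ⟨⟨hz, hzA⟩, hz'⟩
      exact ⟨hz, (htrue z hzA hz').trans hrβ.symm⟩
  · refine hsplit' _ (Or.inr ⟨Y, ?_, _, ⟨E, ε, hE, rfl⟩, rfl⟩) ?_ ?_ b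
    · rcases hY with rfl | ⟨n, rfl | rfl⟩
      · exact Or.inl (Or.inl (Or.inl rfl))
      · exact Or.inl (Or.inl (Or.inr ⟨n, rfl⟩))
      · exact Or.inl (Or.inr ⟨n, rfl⟩)
    · refine (hi.sdiff hYA).mono ?_
      rintro z ⟨hz, hz'⟩
      exact ⟨hz, fun h => hz' ⟨hz.1, h⟩⟩
    · intro β hβ
      have : (Y ∩ S β).Finite := by
        rcases hY with rfl | ⟨n, rfl | rfl⟩
        · rw [(hPM.symm.mono_right (hS β hβ)).inter_eq]
          exact Set.finite_empty
        · rw [inter_comm]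
          exact (hSl β hβ n).1
        · rw [inter_comm]
          exact (hSl β hβ n).2
      exact this.subset (inter_subset_inter_left _ inter_subset_left)
  · simp only [f₀, if_pos hz]

/-- The new point is fitted to the earlier clopen sets, and the new clopen set to all points up to
and including the new one. -/
theorem exists_stages {P Q : ℕ → Set Z} {M : Set Z} [WellFoundedLT I]
    (hPM : Disjoint (⋃ n, P n) M) (hI : ∀ α : I, (Iic α).Countable)
    (x : I → Z ⊕ I) (A C : I → Set Z) (hxA : ∀ α, Separable P Q M (x α) (A α)) :
    ∃ (f : I → Z → Bool) (c : I → I → Bool) (S B : I → Set Z),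
      ∀ α, StageOK P Q M x A C f c S B α := by
  let R : I → (I → (Z → Bool) × (I → Bool) × Set Z × Set Z) → Prop := fun α g =>
    StageOK P Q M x A C (fun β => (g β).1) (fun β => (g β).2.1)
      (fun β => (g β).2.2.1) (fun β => (g β).2.2.2) α
  have hR (α g g') (h : ∀ b ≤ α, g b = g' b) : R α g → R α g' :=
    StageOK.congr (fun β hβ => by rw [h β hβ]) (fun β hβ => by rw [h β hβ])
      (fun β hβ => by rw [h β hβ]) (fun β hβ => by rw [h β hβ])
  suffices step : ∀ α g, (∀ b < α, R b g) → ∃ d, R α (Function.update g α d) by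
    obtain ⟨g, hg⟩ := exists_of_forall_exists_update R hR step
    exact ⟨_, _, _, _, hg⟩
  intro α g ih
  let f : I → Z → Bool := fun β => (g β).1
  let S : I → Set Z := fun β => (g β).2.2.1
  let B : I → Set Z := fun β => (g β).2.2.2
  let c : I → I → Bool := fun β => (g β).2.1
  obtain ⟨c₀, S₀, B₀, h1, h2, h3, h4, h5, h6, h7, h8, h9⟩ :=
    exists_new_point (P := P) (Q := Q) ((hI α).mono Iio_subset_Iic_self) (C α) f S
  let c' := Function.update c α c₀
  let S' := Function.update S α S₀
  let B' := Function.update B α B₀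
  have hc'α : c' α = c₀ := Function.update_self ..
  have hS'α : S' α = S₀ := Function.update_self ..
  have hB'α : B' α = B₀ := Function.update_self ..
  have hS' (β) (hβ : β < α) : S' β = S β := Function.update_of_ne hβ.ne ..
  have hB' (β) (hβ : β < α) : B' β = B β := Function.update_of_ne hβ.ne ..
  have hS'i (β γ : I) (hβ : β ≤ α) (hγ : γ < β) : (S' β ∩ S' γ).Finite := by
    rcases hβ.eq_or_lt with rfl | hβ
    · rw [hS'α, hS' γ hγ]
      exact h3 γ hγ
    · rw [hS' β hβ, hS' γ (hγ.trans hβ)]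
      exact (ih β hβ).S_inter γ hγ
  have hv (γ : I) (hγ : γ < α) : ordVal x c' γ α = c₀ γ := by
    rw [ordVal_of_lt hγ, hc'α]
  classical
  have hvr (β : I) (hβ : β ≤ α) : ordVal x c' α β = decide (x α ≠ Sum.inr β) := by
    simp [ordVal, hβ]
  obtain ⟨f₀, k1, k2, k3, k4, k5, k6⟩ := exists_new_clopen hPM (hI α) (x α) (A α) (C α)
    (hxA α) f (ordVal x c') (fun β => decide (x α ≠ Sum.inr β)) (fun β => by simp) S' B'
    (by
      intro β hβ
      rcases hβ.eq_or_lt with rfl | hβ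
      · rwa [hS'α]
      · rw [hS' β hβ]; exact (ih β hβ).S_sub)
    (by
      intro β hβ
      rcases hβ.eq_or_lt with rfl | hβ
      · rwa [hS'α]
      · rw [hS' β hβ]; exact (ih β hβ).S_light)
    (by
      intro β hβ γ hγ hne
      rcases hne.lt_or_gt with h | h
      · rw [inter_comm]; exact hS'i γ β hγ h
      · exact hS'i β γ hβ h)
    (by
      intro β hβ
      rcases hβ.eq_or_lt with rfl | hβ
      · rwa [hB'α]
      · rw [hB' β hβ]; exact (ih β hβ).B_disj)
    (by
      intro β hβ
      rcases hβ.eq_or_lt with rfl | hβ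
      · rwa [hB'α]
      · rw [hB' β hβ]; exact (ih β hβ).B_light)
  let f' := Function.update f α f₀
  have hf'α : f' α = f₀ := Function.update_self ..
  have hf' (β) (hβ : β < α) : f' β = f β := Function.update_of_ne hβ.ne ..
  have hcyl (E : Finset I) (hE : ∀ γ ∈ E, γ < α) (ε : I → Bool) : cyl f' E ε = cyl f E ε :=
    cyl_congr (fun γ hγ => hf' γ (hE γ hγ)) (fun _ _ => rfl)
  refine ⟨(f₀, c₀, S₀, B₀), ?_⟩
  have main : StageOK P Q M x A C f' c' S' B' α := by
    constructor
    · rwa [hS'α]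
    · rwa [hS'α]
    · exact fun β hβ => hS'i α β le_rfl hβ
    · intro γ hγ
      rw [hS'α, hf' γ hγ, hv γ hγ]
      exact h4 γ hγ
    · intro β hβ
      rw [hf'α, hvr β hβ]
      exact k1 β hβ
    · rwa [hB'α]
    · rwa [hB'α]
    · intro hi E hE
      rw [hB'α] at hi ⊢
      rw [hcyl E hE, cyl_congr (f' := f) (fun _ _ => rfl) (fun γ hγ => hv γ (hE γ hγ))]
      exact h7 hi E
    · intro β hβ E hE
      rw [hcyl E hE, hf'α, hvr β hβ]
      exact k2 β hβ E hE
    · intro Y hY hYA E hE ε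
      rw [hcyl E hE, hf'α]
      exact k3 Y hY hYA E hE ε
    · rwa [hf'α]
    · rwa [hf'α]
    · rwa [hf'α]
    · intro i1 i2 i3
      rcases h8 i1 i2 i3 with ⟨β, hβ, h⟩ | h
      · exact ⟨β, hβ.le, by rwa [hS' β hβ]⟩
      · exact ⟨α, le_rfl, by rwa [hS'α]⟩
    · rwa [hB'α]
  refine main.congr (fun β _ => ?_) (fun β _ => ?_) (fun β _ => ?_) (fun β _ => ?_) <;>
  · simp only [f', c', S', B', f, c, S, B, Function.update_apply]
    split_ifs <;> rfl

end Construction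

/-! ### Properties of the completed construction -/

section Consequences

variable {Z I : Type*} [LinearOrder I] {P Q : ℕ → Set Z} {M : Set Z} {x : I → Z ⊕ I}
  {A C : I → Set Z} {f : I → Z → Bool} {c : I → I → Bool} {S B : I → Set Z}

theorem StageOK.eventually_eq (h : ∀ α, StageOK P Q M x A C f c S B α) (γ β : I) :
    {z ∈ S β | f γ z ≠ ordVal x c γ β}.Finite := by
  rcases lt_or_ge γ β with hγ | hγ
  · exact (h β).S_col γ hγ
  · exact (h γ).S_row β hγ

theorem StageOK.finite_diff_cyl (h : ∀ α, StageOK P Q M x A C f c S B α) (β : I) (E : Finset I) :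
    (S β \ cyl f E fun γ => ordVal x c γ β).Finite := by
  refine (E.finite_toSet.biUnion fun γ _ => StageOK.eventually_eq h γ β).subset ?_
  rintro z ⟨hz, hne⟩
  simp only [cyl, Set.mem_ofPred_eq, not_forall] at hne
  obtain ⟨γ, hγ, hne⟩ := hne
  exact Set.mem_biUnion (x := γ) hγ ⟨hz, hne⟩

/-- Induction on the largest index in `E`: `B_row` adds an index `α ≥ β` above the others, while for
`α < β` the whole cylinder is covered by `B_col`. -/
theorem StageOK.infinite_inter_cyl_ordVal (h : ∀ α, StageOK P Q M x A C f c S B α) {β : I}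
    (hβ : (B β).Infinite) (E : Finset I) : (B β ∩ cyl f E fun γ => ordVal x c γ β).Infinite := by
  induction E using Finset.induction_on_max with
  | empty => rwa [cyl_empty, inter_univ]
  | insert α E hE ih =>
    rcases lt_or_ge α β with hα | hα
    · refine (h β).B_col hβ _ fun γ hγ => ?_
      rcases Finset.mem_insert.1 hγ with rfl | hγ
      exacts [hα, (hE γ hγ).trans hα]
    · rw [cyl_insert]
      exact (h α).B_row β hα E hE ih

theorem StageOK.infinite_inter_cyl (h : ∀ α, StageOK P Q M x A C f c S B α) {Y : Set Z}
    (hY : Y = M ∨ ∃ n, Y = P n ∨ Y = Q n) (hinf : Y.Infinite) (E : Finset I)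
    (hYA : ∀ α ∈ E, (Y ∩ A α).Finite) (ε : I → Bool) : (Y ∩ cyl f E ε).Infinite := by
  induction E using Finset.induction_on_max with
  | empty => rwa [cyl_empty, inter_univ]
  | insert α E hE ih =>
    rw [cyl_insert]
    exact (h α).split Y hY (hYA α (Finset.mem_insert_self _ _)) E hE ε
      (ih fun γ hγ => hYA γ (Finset.mem_insert_of_mem hγ)) _

/-- The families `P`, `Q` and the set `M` consist of infinite, pairwise disjoint sets. -/
structure IsPieces (P Q : ℕ → Set Z) (M : Set Z) : Prop where
  P_inf : ∀ n, (P n).Infinite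
  Q_inf : ∀ n, (Q n).Infinite
  M_inf : M.Infinite
  P_disj : Pairwise fun m n => Disjoint (P m) (P n)
  Q_disj : Pairwise fun m n => Disjoint (Q m) (Q n)
  PQ : Disjoint (⋃ n, P n) (⋃ n, Q n)
  PM : Disjoint (⋃ n, P n) M
  QM : Disjoint (⋃ n, Q n) M

theorem IsPieces.P_inter_Q (h : IsPieces P Q M) (m n : ℕ) : P m ∩ Q n = ∅ :=
  (h.PQ.mono (subset_iUnion P m) (subset_iUnion Q n)).inter_eq

theorem IsPieces.M_inter_finite {J : Type*} (h : IsPieces P Q M) {y : Z ⊕ J} {A₀ : Set Z}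
    (hA : Separable P Q M y A₀) : (M ∩ A₀).Finite := by
  rcases hA with ⟨n, rfl⟩ | ⟨-, hM, -⟩
  · rw [inter_union_distrib_left, (h.PM.symm.mono_right (subset_iUnion P n)).inter_eq,
      (h.QM.symm.mono_right (subset_iUnion Q n)).inter_eq]
    simp
  · rwa [inter_comm]

theorem IsPieces.eventually_inter_finite {J : Type*} (h : IsPieces P Q M) {y : Z ⊕ J} {A₀ : Set Z}
    (hA : Separable P Q M y A₀) : ∀ᶠ n in atTop, (P n ∩ A₀).Finite ∧ (Q n ∩ A₀).Finite := by
  rcases hA with ⟨m, rfl⟩ | ⟨hl, -⟩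
  · filter_upwards [eventually_gt_atTop m] with n hn
    rw [inter_union_distrib_left, inter_union_distrib_left, (h.P_disj hn.ne').inter_eq,
      (h.Q_disj hn.ne').inter_eq, h.P_inter_Q, inter_comm (Q n), h.P_inter_Q]
    simp
  · refine Eventually.of_forall fun n => ?_
    rw [inter_comm (P n), inter_comm (Q n)]
    exact hl n

theorem IsPieces.infinite_M_inter_cyl (hp : IsPieces P Q M)
    (h : ∀ α, StageOK P Q M x A C f c S B α) (hA : ∀ α, Separable P Q M (x α) (A α))
    (E : Finset I) (ε : I → Bool) : (M ∩ cyl f E ε).Infinite :=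
  StageOK.infinite_inter_cyl h (Or.inl rfl) hp.M_inf E (fun α _ => hp.M_inter_finite (hA α)) ε

theorem IsPieces.eventually_infinite_inter_cyl (hp : IsPieces P Q M)
    (h : ∀ α, StageOK P Q M x A C f c S B α) (hA : ∀ α, Separable P Q M (x α) (A α))
    (E : Finset I) (ε : I → Bool) :
    ∀ᶠ n in atTop, (P n ∩ cyl f E ε).Infinite ∧ (Q n ∩ cyl f E ε).Infinite := by
  have := (Filter.eventually_all_finset E).2 fun α _ => hp.eventually_inter_finite (hA α)
  filter_upwards [this] with n hn
  exact ⟨StageOK.infinite_inter_cyl h (Or.inr ⟨n, Or.inl rfl⟩) (hp.P_inf n) E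
      (fun α hα => (hn α hα).1) ε,
    StageOK.infinite_inter_cyl h (Or.inr ⟨n, Or.inr rfl⟩) (hp.Q_inf n) E
      (fun α hα => (hn α hα).2) ε⟩

/-- Every triple of parameters is used at arbitrarily late stages. -/
def IsCofinalTask (P Q : ℕ → Set Z) (M : Set Z) (x : I → Z ⊕ I) (A C : I → Set Z) : Prop :=
  ∀ y A₀ C₀, Separable P Q M y A₀ → ∀ α, ∃ β ≥ α, x β = y ∧ A β = A₀ ∧ C β = C₀

theorem IsCofinalTask.exists_eq [Nonempty I] (ht : IsCofinalTask P Q M x A C) (C₀ : Set Z) :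
    ∃ β, C β = C₀ := by
  inhabit I
  obtain ⟨β, -, -, -, h⟩ := ht (Sum.inr default) (P 0 ∪ Q 0) C₀ (Or.inl ⟨0, rfl⟩) default
  exact ⟨β, h⟩

theorem IsCofinalTask.exists_infinite_inter [Nonempty I] (ht : IsCofinalTask P Q M x A C)
    (h : ∀ α, StageOK P Q M x A C f c S B α) {Y : Set Z} (hY : Y.Infinite) (hl : IsLight P Q Y)
    (hP : Y ⊆ ⋃ n, P n) : ∃ β, (Y ∩ S β).Infinite := by
  obtain ⟨α, rfl⟩ := ht.exists_eq Y
  obtain ⟨β, -, hβ⟩ := (h α).hit hY hl hP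
  exact ⟨β, hβ⟩

theorem IsCofinalTask.exists_B_eq [Nonempty I] (ht : IsCofinalTask P Q M x A C)
    (h : ∀ α, StageOK P Q M x A C f c S B α) {Y : Set Z} (hl : IsLight P Q Y)
    (hP : Disjoint Y (⋃ n, P n)) : ∃ β, B β = Y := by
  obtain ⟨α, rfl⟩ := ht.exists_eq Y
  exact ⟨α, (h α).B_eq hl hP⟩

/-- A set that is not almost covered by finitely many of the sets `S β` is split. -/
theorem IsCofinalTask.exists_split (ht : IsCofinalTask P Q M x A C) [Nonempty I] [Nonempty Z]
    (h : ∀ α, StageOK P Q M x A C f c S B α) {Y : Set Z}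
    (hY : ∀ G : Finset I, (Y \ ⋃ β ∈ G, S β).Infinite) :
    ∃ α, ∀ b, {z ∈ Y | f α z = b}.Infinite := by
  inhabit I
  inhabit Z
  -- With `∅` as the set to be separated, only the `S β` can prevent splitting.
  obtain ⟨α, -, -, hA, rfl⟩ := ht (Sum.inl default) ∅ Y
    (Or.inr ⟨isLight_empty, by simp, _, rfl⟩) default
  refine ⟨α, (h α).split_task fun G _ => ?_⟩
  rw [hA, empty_union]
  exact hY G

/-- There are points in every cylinder outside of a given countable set. -/
theorem IsCofinalTask.exists_notMem_cyl [Nonempty I] (ht : IsCofinalTask P Q M x A C)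
    (hp : IsPieces P Q M)
    (h : ∀ α, StageOK P Q M x A C f c S B α) (hA : ∀ α, Separable P Q M (x α) (A α))
    (E : Finset I) (ε : I → Bool) {W : Set I} (hW : W.Countable) :
    ∃ β ∉ W, ∀ γ ∈ E, ordVal x c γ β = ε γ := by
  have : Countable W := hW.to_subtype
  obtain ⟨e, he⟩ := exists_injective_nat W
  have hfin (n : ℕ) : {j | e j ≤ n}.Finite := (Set.finite_Iic n).preimage he.injOn
  obtain ⟨N, hN⟩ := eventually_atTop.1 (hp.eventually_infinite_inter_cyl h hA E ε)
  -- A transversal of the pieces inside the cylinder, almost disjoint from every `S j` with `j ∈ W`.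
  -- An `S β` that meets it infinitely has `β ∉ W`, and convergence of `S β` puts `β` into the
  -- cylinder.
  obtain ⟨z, hzinj, hz⟩ := exists_injective_forall_mem
    (fun k => (P (N + k) ∩ cyl f E ε) \ ⋃ j ∈ (hfin k).toFinset, S j) fun k => by
      refine ((hN (N + k) (by omega)).1.sdiff (Set.Finite.biUnion (Finset.finite_toSet (hfin k).toFinset)
        fun j _ => ((h j).S_light (N + k)).1)).mono ?_
      rintro y ⟨hy, hy'⟩
      refine ⟨hy, fun hj => hy' ?_⟩
      obtain ⟨j, hj, hyj⟩ := Set.mem_iUnion₂.1 hj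
      exact Set.mem_biUnion (x := j) hj ⟨hyj, hy.1⟩
  have hP : range z ⊆ ⋃ n, P n := by
    rintro _ ⟨k, rfl⟩
    exact Set.mem_iUnion.2 ⟨_, (hz k).1.1⟩
  have hl : IsLight P Q (range z) := by
    refine fun n => ⟨((Set.finite_Iic n).image z).subset ?_, ?_⟩
    · rintro _ ⟨⟨k, rfl⟩, hk⟩
      refine ⟨k, ?_, rfl⟩
      by_contra hkn
      have : k > n := not_le.1 hkn
      exact Set.disjoint_left.1 (hp.P_disj (show N + k ≠ n by omega)) (hz k).1.1 hk
    · rw [((hp.PQ.mono_left hP).mono_right (subset_iUnion Q n)).inter_eq]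
      exact Set.finite_empty
  obtain ⟨β, hβ⟩ := ht.exists_infinite_inter h (infinite_range_of_injective hzinj) hl hP
  refine ⟨β, fun hβW => hβ (((Set.finite_Iio (e ⟨β, hβW⟩)).image z).subset ?_), ?_⟩
  · rintro _ ⟨⟨k, rfl⟩, hk⟩
    refine ⟨k, ?_, rfl⟩
    by_contra hkn
    refine (hz k).2 (Set.mem_biUnion (x := (⟨β, hβW⟩ : W)) ?_ hk)
    simpa using hkn
  · have hd := (StageOK.finite_diff_cyl h β E).subset
      (sdiff_subset_sdiff_left (inter_subset_right : range z ∩ S β ⊆ S β))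
    obtain ⟨_, ⟨⟨k, rfl⟩, hk⟩, hk'⟩ := (hβ.sdiff hd).nonempty
    have hk' : z k ∈ cyl f E fun γ => ordVal x c γ β := by
      by_contra hn
      exact hk' ⟨⟨⟨k, rfl⟩, hk⟩, hn⟩
    exact fun γ hγ => (hk' γ hγ).symm.trans ((hz k).1.2 γ hγ)

end Consequences

/-! ### The induced topology and its properties -/

theorem exists_finset_of_isOpen_induced {X I : Type*} (F : I → X → Bool) {U : Set X}
    (hU : IsOpen[TopologicalSpace.induced (fun p γ => F γ p) Pi.topologicalSpace] U) {p : X}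
    (hp : p ∈ U) : ∃ E : Finset I, {q | ∀ γ ∈ E, F γ q = F γ p} ⊆ U := by
  obtain ⟨V, hV, rfl⟩ := isOpen_induced_iff.1 hU
  obtain ⟨E, u, hu, hE⟩ := isOpen_pi_iff.1 hV _ hp
  refine ⟨E, fun q hq => hE fun γ hγ => ?_⟩
  have h := (hu γ hγ).2
  dsimp only at h ⊢
  rwa [hq γ hγ]

theorem isClopen_induced_eq {X I : Type*} (F : I → X → Bool) (γ : I) (b : Bool) :
    @IsClopen X (TopologicalSpace.induced (fun p γ => F γ p) Pi.topologicalSpace)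
      {q | F γ q = b} := by
  let τ := TopologicalSpace.induced (fun p γ => F γ p) (Pi.topologicalSpace (Y := fun _ : I => Bool))
  have : Continuous (F γ) := (continuous_apply γ).comp
    (continuous_induced_dom (f := fun (p : X) (γ : I) => F γ p))
  exact (isClopen_discrete {b}).preimage this

theorem isZeroDimensional_induced {X I : Type*} (F : I → X → Bool) :
    @IsZeroDimensional X
      (TopologicalSpace.induced (fun p γ => F γ p) Pi.topologicalSpace) := by
  let τ := TopologicalSpace.induced (fun p γ => F γ p) (Pi.topologicalSpace (Y := fun _ : I => Bool))
  refine TopologicalSpace.isTopologicalBasis_of_isOpen_of_nhds (fun U hU => hU.isOpen) ?_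
  intro p U hp hU
  obtain ⟨E, hE⟩ := exists_finset_of_isOpen_induced F hU hp
  refine ⟨{q | ∀ γ ∈ E, F γ q = F γ p}, ?_, fun γ _ => rfl, hE⟩
  have : {q | ∀ γ ∈ E, F γ q = F γ p} = ⋂ γ ∈ E, {q | F γ q = F γ p} := by ext; simp
  rw [this]
  exact isClopen_biInter_finset fun γ _ => isClopen_induced_eq F γ _

theorem exists_forall_le_of_countable {I : Type*} [LinearOrder I] [Uncountable I]
    (hI : ∀ α : I, (Iic α).Countable) {Γ : Set I} (hΓ : Γ.Countable) : ∃ α, ∀ γ ∈ Γ, γ ≤ α := by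
  by_contra! h
  refine Set.not_countable_univ (α := I) ((hΓ.biUnion fun γ _ => hI γ).mono fun α _ => ?_)
  obtain ⟨γ, hγ, hlt⟩ := h α
  exact Set.mem_biUnion hγ hlt.le

theorem mem_smallTraces_image {Z X : Type*} {i : Z → X} (hi : Function.Injective i)
    {P : ℕ → Set Z} {Y : Set X} (hY : Y ∈ smallTraces fun n => i '' P n) :
    ∃ Y₀ ∈ smallTraces P, Y = i '' Y₀ := by
  obtain ⟨hinf, hsub, hfin⟩ := hY
  have hr : Y ⊆ range i := hsub.trans (iUnion_subset fun n => image_subset_range _ _)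
  have hYi : Y = i '' (i ⁻¹' Y) := (image_preimage_eq_of_subset hr).symm
  refine ⟨i ⁻¹' Y, ⟨?_, ?_, fun n => ?_⟩, hYi⟩
  · exact hinf.preimage hr
  · intro z hz
    obtain ⟨n, z', hz', he⟩ := Set.mem_iUnion.1 (hsub hz)
    exact Set.mem_iUnion.2 ⟨n, hi he ▸ hz'⟩
  · refine ((hfin n).preimage hi.injOn).subset ?_
    rintro z ⟨hz, hzn⟩
    exact ⟨hz, z, hzn, rfl⟩

theorem IsPieces.isLight_of_mem_P {Z : Type*} {P Q : ℕ → Set Z} {M Y : Set Z}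
    (hp : IsPieces P Q M) (hY : Y ∈ smallTraces P) : IsLight P Q Y := fun n =>
  ⟨hY.2.2 n, by
    rw [((hp.PQ.mono_left hY.2.1).mono_right (subset_iUnion Q n)).inter_eq]
    exact Set.finite_empty⟩

theorem IsPieces.isLight_of_mem_Q {Z : Type*} {P Q : ℕ → Set Z} {M Y : Set Z}
    (hp : IsPieces P Q M) (hY : Y ∈ smallTraces Q) : IsLight P Q Y := fun n =>
  ⟨by
    rw [((hp.PQ.symm.mono_left hY.2.1).mono_right (subset_iUnion P n)).inter_eq]
    exact Set.finite_empty, hY.2.2 n⟩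

theorem IsPieces.isLight_of_subset_M {Z : Type*} {P Q : ℕ → Set Z} {M Y : Set Z}
    (hp : IsPieces P Q M) (hY : Y ⊆ M) : IsLight P Q Y := fun n => by
  rw [((hp.PM.symm.mono_left hY).mono_right (subset_iUnion P n)).inter_eq,
    ((hp.QM.symm.mono_left hY).mono_right (subset_iUnion Q n)).inter_eq]
  simp

theorem exists_topology {X Z I : Type*} [LinearOrder I] [WellFoundedLT I] [Uncountable I]
    [Countable Z]
    (hI : ∀ α : I, (Iic α).Countable) {i : Z → X} {o : I → X} (hi : Function.Injective i)
    (ho : Function.Injective o) (hio : ∀ z β, i z ≠ o β)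
    (hcov : ∀ p, (∃ z, i z = p) ∨ ∃ β, o β = p)
    {P Q : ℕ → Set Z} {M : Set Z} (hp : IsPieces P Q M) {x : I → Z ⊕ I} {A C : I → Set Z}
    (hA : ∀ α, Separable P Q M (x α) (A α)) (ht : IsCofinalTask P Q M x A C) :
    ∃ _τ : TopologicalSpace X,
      IsZeroDimensional X ∧ T2Space X ∧
      (∀ U : Set X, IsOpen U → U.Nonempty → ¬ (U ∩ range o).Countable ∧ (U ∩ i '' M).Infinite ∧
        ∀ᶠ n in atTop, (U ∩ i '' P n).Infinite ∧ (U ∩ i '' Q n).Infinite) ∧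
      (∀ Y ∈ smallTraces (fun n => i '' P n), ∃ Y' ⊆ Y, Y'.Infinite ∧ SetConverges Y') ∧
      (∀ Y ∈ ctblInfSubsets (univ : Set X), SetConverges Y →
        (Y \ i '' ⋃ n, P n).Finite ∧ Y ∩ i '' (⋃ n, P n) ∈ smallTraces (fun n => i '' P n)) ∧
      (∀ Y ∈ smallTraces (fun n => i '' P n) ∪ smallTraces (fun n => i '' Q n),
        (accPts Y).Nonempty ∧ accPts Y ⊆ range o) ∧
      (∀ Y ∈ ctblInfSubsets (i '' M), (accPts Y ∩ range o).Nonempty) ∧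
      (∀ n, accPts (i '' P n) = ∅ ∧ accPts (i '' Q n) = ∅) ∧
      (∀ Γ ∈ ctblInfSubsets (range o), accPts Γ = ∅) := by
  classical
  obtain ⟨f, c, S, B, h⟩ := exists_stages hp.PM hI x A C hA
  have : Nonempty Z := (hp.M_inf.nonempty).to_type
  let F : I → X → Bool := fun γ =>
    Function.extend i (f γ) (Function.extend o (ordVal x c γ) fun _ => true)
  have hFi (γ z) : F γ (i z) = f γ z := hi.extend_apply _ _ _
  have hFo (γ β) : F γ (o β) = ordVal x c γ β := by
    simp only [F]
    rw [Function.extend_apply' _ _ _ (by rintro ⟨z, hz⟩; exact hio z β hz), ho.extend_apply]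
  let τ : TopologicalSpace X :=
    TopologicalSpace.induced (fun p γ => F γ p) Pi.topologicalSpace
  have hopen (γ : I) (b : Bool) : IsOpen {q | F γ q = b} := (isClopen_induced_eq F γ b).isOpen
  have hbase {U : Set X} (hU : IsOpen U) {p : X} (hpU : p ∈ U) :
      ∃ E : Finset I, {q | ∀ γ ∈ E, F γ q = F γ p} ⊆ U := exists_finset_of_isOpen_induced F hU hpU
  -- separation of a point from late sets
  have hsep (y : Z ⊕ I) (A₀ : Set Z) (hy : Separable P Q M y A₀) {Γ : Set I} (hΓ : Γ.Countable) :
      ∃ γ, F γ (y.elim i o) = false ∧ (∀ z ∈ A₀, y ≠ Sum.inl z → F γ (i z) = true) ∧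
        ∀ β ∈ Γ, y ≠ Sum.inr β → F γ (o β) = true := by
    obtain ⟨α₀, hα₀⟩ := exists_forall_le_of_countable hI hΓ
    -- The stage must come after the relevant ordinals, so that `ordVal` tests equality with `x γ`
    -- instead of using a prescribed value.
    obtain ⟨α₁, hα₁⟩ : ∃ α₁, α₀ ≤ α₁ ∧ ∀ β, y = Sum.inr β → β ≤ α₁ := by
      cases y with
      | inl z => exact ⟨α₀, le_rfl, by simp⟩
      | inr β => exact ⟨max α₀ β, le_max_left _ _, by
          rintro _ ⟨⟩
          exact le_max_right _ _⟩
    obtain ⟨γ, hγ, rfl, rfl, -⟩ := ht y A₀ ∅ hy α₁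
    refine ⟨γ, ?_, fun z hz hne => ?_, fun β hβ hne => ?_⟩
    · rcases hx : x γ with z | β
      · simpa [hFi] using (h γ).sep_false z hx
      · rw [Sum.elim_inr, hFo, ← Bool.not_eq_true,
          ordVal_of_le ((hα₁.2 β hx).trans hγ), not_not]
        exact hx
    · rw [hFi]
      exact (h γ).sep_true z hz hne
    · rw [hFo, ordVal_of_le ((hα₀ β hβ).trans (hα₁.1.trans hγ))]
      exact hne
  have hcov' (p : X) : ∃ y : Z ⊕ I, y.elim i o = p := by
    rcases hcov p with ⟨z, rfl⟩ | ⟨β, rfl⟩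
    exacts [⟨Sum.inl z, rfl⟩, ⟨Sum.inr β, rfl⟩]
  -- cylinders
  have hcyl (E : Finset I) (p : X) (Y : Set Z) {U : Set X}
      (hU : {q | ∀ γ ∈ E, F γ q = F γ p} ⊆ U) (hY : (Y ∩ cyl f E fun γ => F γ p).Infinite) :
      (U ∩ i '' Y).Infinite := by
    refine (hY.image hi.injOn).mono ?_
    rintro _ ⟨z, ⟨hz, hzc⟩, rfl⟩
    exact ⟨hU fun γ hγ => (hFi γ z).trans (hzc γ hγ), z, hz, rfl⟩
  have hconv (β : I) (Y : Set Z) (hY : Y ⊆ S β) {U : Set X} (hU : IsOpen U) (hβ : o β ∈ U) :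
      (i '' Y \ U).Finite := by
    obtain ⟨E, hE⟩ := hbase hU hβ
    refine ((StageOK.finite_diff_cyl h β E).image i).subset ?_
    rintro _ ⟨⟨z, hz, rfl⟩, hzU⟩
    refine ⟨z, ⟨hY hz, fun hz' => hzU (hE fun γ hγ => ?_)⟩, rfl⟩
    rw [hFi, hFo]
    exact hz' γ hγ
  have haccB (β : I) (hβ : (B β).Infinite) : o β ∈ accPts (i '' B β) := by
    intro U hU hβU
    obtain ⟨E, hE⟩ := hbase hU hβU
    refine hcyl E (o β) (B β) hE ?_
    simp only [hFo]
    exact StageOK.infinite_inter_cyl_ordVal h hβ E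
  have hb (Y : Set X) (hY : Y ∈ smallTraces (fun n => i '' P n)) :
      ∃ β, ∃ Y' ⊆ Y, Y'.Infinite ∧ ∀ U : Set X, IsOpen U → o β ∈ U → (Y' \ U).Finite := by
    obtain ⟨Y₀, hY₀, rfl⟩ := mem_smallTraces_image hi hY
    obtain ⟨β, hβ⟩ := ht.exists_infinite_inter h hY₀.1 (hp.isLight_of_mem_P hY₀) hY₀.2.1
    exact ⟨β, i '' (Y₀ ∩ S β), image_mono inter_subset_left, hβ.image hi.injOn,
      fun U hU hβU => hconv β _ inter_subset_right hU hβU⟩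
  have haccQ (Y : Set Z) (hY : Y.Infinite) (hl : IsLight P Q Y) (hd : Disjoint Y (⋃ n, P n)) :
      ∃ β, o β ∈ accPts (i '' Y) := by
    obtain ⟨β, rfl⟩ := ht.exists_B_eq h hl hd
    exact ⟨β, haccB β hY⟩
  have hnot (z : Z) (Y : Set Z) (hY : Separable P Q M (Sum.inl z : Z ⊕ I) Y) :
      i z ∉ accPts (i '' Y) := by
    intro hz
    obtain ⟨γ, h1, h2, -⟩ := hsep _ Y hY Set.countable_empty
    refine hz {q | F γ q = false} (hopen γ false) h1 ((Set.finite_singleton (i z)).subset ?_)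
    rintro _ ⟨hq, z', hz', rfl⟩
    by_contra hne
    have := h2 z' hz' fun he => hne (by rw [Sum.inl_injective he]; rfl)
    simp_all
  have hPQacc (n : ℕ) (p : X) : p ∉ accPts (i '' (P n ∪ Q n)) := by
    intro hz
    obtain ⟨y, rfl⟩ := hcov' p
    obtain ⟨γ, h1, h2, -⟩ := hsep y (P n ∪ Q n) (Or.inl ⟨n, rfl⟩) Set.countable_empty
    refine hz {q | F γ q = false} (hopen γ false) h1
      ((Set.finite_singleton (y.elim i o)).subset ?_)
    rintro _ ⟨hq, z', hz', rfl⟩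
    by_contra hne
    have := h2 z' hz' fun he => hne (by rw [he]; rfl)
    simp_all
  have hmono {Y Y' : Set X} (hYY : Y ⊆ Y') : accPts Y ⊆ accPts Y' := fun p hpY U hU hpU =>
    (hpY U hU hpU).mono (inter_subset_inter_right _ hYY)
  -- countable sets of ordinals are closed and discrete
  have hΓsep (Γ : Set X) (hΓ : Γ ⊆ range o) (hc : Γ.Countable) (p : X) :
      ∃ U : Set X, IsOpen U ∧ p ∈ U ∧ (U ∩ Γ).Finite := by
    obtain ⟨y, rfl⟩ := hcov' p
    -- `P 0 ∪ Q 0` is a dummy, admissible for every point; what matters is the value at the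
    -- ordinals.
    obtain ⟨γ, h1, -, h2⟩ := hsep y (P 0 ∪ Q 0) (Or.inl ⟨0, rfl⟩)
      (hc.preimage_of_injOn (f := o) ho.injOn)
    refine ⟨{q | F γ q = false}, hopen γ false, h1,
      (Set.finite_singleton (y.elim i o)).subset ?_⟩
    rintro q ⟨hq, hqΓ⟩
    obtain ⟨β, rfl⟩ := hΓ hqΓ
    by_contra hne
    have := h2 β hqΓ fun he => hne (by rw [he]; rfl)
    simp_all
  have hinj : Function.Injective fun p γ => F γ p := by
    have key (z : Z) (p : X) (hzp : (fun γ => F γ (i z)) = fun γ => F γ p) : i z = p := by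
      by_contra hne
      rcases hcov p with ⟨z', rfl⟩ | ⟨β, rfl⟩
      · obtain ⟨γ, h1, h2, -⟩ := hsep (Sum.inl z) {z'}
          (Or.inr ⟨fun n => ⟨(Set.finite_singleton _).inter_of_left _,
            (Set.finite_singleton _).inter_of_left _⟩,
            (Set.finite_singleton _).inter_of_left _, z, rfl⟩) Set.countable_empty
        have h2 := h2 z' rfl fun he => hne (by rw [Sum.inl_injective he])
        have := congrFun hzp γ
        simp_all
      · obtain ⟨γ, h1, -, h2⟩ := hsep (Sum.inl z) (P 0 ∪ Q 0) (Or.inl ⟨0, rfl⟩)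
          (Set.countable_singleton β)
        have h2 := h2 β rfl (by simp)
        have := congrFun hzp γ
        simp_all
    intro p q hpq
    rcases hcov p with ⟨z, rfl⟩ | ⟨β, rfl⟩
    · exact key z q hpq
    rcases hcov q with ⟨z, rfl⟩ | ⟨β', rfl⟩
    · exact (key z _ hpq.symm).symm
    by_contra hne
    obtain ⟨γ, h1, -, h2⟩ := hsep (Sum.inr β) (P 0 ∪ Q 0) (Or.inl ⟨0, rfl⟩)
      (Set.countable_singleton β')
    have h2 := h2 β' rfl fun he => hne (by rw [Sum.inr_injective he])
    have := congrFun hpq γ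
    simp_all
  refine ⟨τ, isZeroDimensional_induced F, ?_, ?_, ?_, ?_, ?_, ?_, ?_, ?_⟩
  · exact T2Space.of_injective_continuous hinj continuous_induced_dom
  · rintro U hU ⟨p, hpU⟩
    obtain ⟨E, hE⟩ := hbase hU hpU
    refine ⟨fun hcount => ?_, hcyl E p M hE (hp.infinite_M_inter_cyl h hA E _), ?_⟩
    · obtain ⟨β, hβ, hβ'⟩ := ht.exists_notMem_cyl hp h hA E (fun γ => F γ p)
        (hcount.preimage_of_injOn (f := o) ho.injOn)
      refine hβ ⟨hE fun γ hγ => ?_, β, rfl⟩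
      rw [hFo]
      exact hβ' γ hγ
    · filter_upwards [hp.eventually_infinite_inter_cyl h hA E fun γ => F γ p] with n hn
      exact ⟨hcyl E p _ hE hn.1, hcyl E p _ hE hn.2⟩
  · intro Y hY
    obtain ⟨β, Y', hY', hinf, hc⟩ := hb Y hY
    exact ⟨Y', hY', hinf, o β, hc⟩
  · rintro Y ⟨-, hYc, hYinf⟩ ⟨p, hpY⟩
    have hord : (Y ∩ range o).Finite := by
      obtain ⟨U, hU, hpU, hfin⟩ := hΓsep (Y ∩ range o) inter_subset_right
        (hYc.mono inter_subset_left) p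
      refine (hfin.union (hpY U hU hpU)).subset fun q hq => ?_
      by_cases hqU : q ∈ U
      exacts [Or.inl ⟨hqU, hq⟩, Or.inr ⟨hq.1, hqU⟩]
    -- Otherwise some `f γ` takes both values infinitely often on `Y`, though convergence to `p`
    -- makes it almost constant there.
    obtain ⟨G, hG⟩ : ∃ G : Finset I, (i ⁻¹' Y \ ⋃ β ∈ G, S β).Finite := by
      by_contra! hcon
      obtain ⟨γ, hγ⟩ := ht.exists_split h hcon
      refine ((hγ (!F γ p)).image hi.injOn) ((hpY {q | F γ q = F γ p} (hopen _ _) rfl).subset ?_)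
      rintro _ ⟨z, ⟨hz, hz'⟩, rfl⟩
      refine ⟨hz, fun he => ?_⟩
      have he : F γ (i z) = F γ p := he
      rw [hFi, hz'] at he
      simp at he
    have hfin : (Y \ i '' ⋃ n, P n).Finite := by
      refine (hord.union (hG.image i)).subset ?_
      rintro q ⟨hq, hqP⟩
      rcases hcov q with ⟨z, rfl⟩ | ⟨β, rfl⟩
      · right
        refine ⟨z, ⟨hq, fun hz => hqP ?_⟩, rfl⟩
        obtain ⟨β, -, hβ⟩ := Set.mem_iUnion₂.1 hz
        exact ⟨z, (h β).S_sub hβ, rfl⟩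
      · exact Or.inl ⟨hq, β, rfl⟩
    refine ⟨hfin, ?_, ?_, fun n => ?_⟩
    · intro hfin'
      exact hYinf ((hfin'.union hfin).subset (by rw [inter_union_sdiff]))
    · rintro _ ⟨-, z, hz, rfl⟩
      obtain ⟨n, hn⟩ := Set.mem_iUnion.1 hz
      exact Set.mem_iUnion.2 ⟨n, z, hn, rfl⟩
    · have h1 : ((⋃ β ∈ G, S β) ∩ P n).Finite := by
        rw [iUnion₂_inter]
        exact G.finite_toSet.biUnion fun β _ => ((h β).S_light n).1
      refine ((hG.union h1).image i).subset ?_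
      rintro _ ⟨⟨hzY, -⟩, z, hz, rfl⟩
      refine ⟨z, ?_, rfl⟩
      by_cases hzG : z ∈ ⋃ β ∈ G, S β
      exacts [Or.inr ⟨hzG, hz⟩, Or.inl ⟨hzY, hzG⟩]
  · intro Y hY
    have hsub (Y₀ : Set Z) (hl : IsLight P Q Y₀) (hM : Disjoint Y₀ M) :
        accPts (i '' Y₀) ⊆ range o := by
      intro p hpY
      rcases hcov p with ⟨z, rfl⟩ | ⟨β, rfl⟩
      · exact absurd hpY (hnot z Y₀ (Or.inr ⟨hl, by simp [hM.inter_eq], z, rfl⟩))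
      · exact ⟨β, rfl⟩
    rcases hY with hY | hY
    · refine ⟨?_, ?_⟩
      · obtain ⟨β, Y', hY', hinf, hc⟩ := hb Y hY
        refine ⟨o β, hmono hY' fun U hU hβU => ?_⟩
        refine (hinf.sdiff (hc U hU hβU)).mono ?_
        rintro q ⟨hq, hq'⟩
        exact ⟨not_not.1 fun hqU => hq' ⟨hq, hqU⟩, hq⟩
      · obtain ⟨Y₀, hY₀, rfl⟩ := mem_smallTraces_image hi hY
        exact hsub Y₀ (hp.isLight_of_mem_P hY₀) (hp.PM.mono_left hY₀.2.1)
    · obtain ⟨Y₀, hY₀, rfl⟩ := mem_smallTraces_image hi hY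
      have hl := hp.isLight_of_mem_Q hY₀
      obtain ⟨β, hβ⟩ := haccQ Y₀ hY₀.1 hl (hp.PQ.symm.mono_left hY₀.2.1)
      exact ⟨⟨_, hβ⟩, hsub Y₀ hl (hp.QM.mono_left hY₀.2.1)⟩
  · rintro Y ⟨hYM, -, hinf⟩
    obtain ⟨Y₀, hY₀, rfl⟩ := Set.subset_image_iff.1 hYM
    obtain ⟨β, hβ⟩ := haccQ Y₀ (hinf.of_image i) (hp.isLight_of_subset_M hY₀)
      (hp.PM.symm.mono_left hY₀)
    exact ⟨o β, hβ, β, rfl⟩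
  · intro n
    constructor <;> refine Set.eq_empty_iff_forall_notMem.2 fun p hpn => hPQacc n p (hmono ?_ hpn)
    exacts [image_mono subset_union_left, image_mono subset_union_right]
  · rintro Γ ⟨hΓ, hc, -⟩
    refine Set.eq_empty_iff_forall_notMem.2 fun p hpΓ => ?_
    obtain ⟨U, hU, hpU, hfin⟩ := hΓsep Γ hΓ hc p
    exact hpΓ U hU hpU hfin

/-! ### Enumeration of the tasks -/

/-- If there are as many stages as sets of natural numbers, then the tasks can be listed in such a
way that each of them occurs cofinally. -/
theorem exists_cofinal_enumeration {Z : Type*} [Countable Z] [Nonempty Z]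
    {I : Type*} [LinearOrder I] [Uncountable I] (hI : ∀ α : I, (Iic α).Countable)
    (e : Set ℕ ≃ I) :
    ∃ t : I → (Z ⊕ I) × Set Z × Set Z, ∀ y, ∀ α, ∃ β ≥ α, t β = y := by
  classical
  obtain ⟨d⟩ : Nonempty (Set ℕ ≃ Set ℕ × Set ℕ) := by
    rw [← Cardinal.eq]
    simp
  obtain ⟨s, hs⟩ := exists_surjective_nat Z
  have hpow : Function.Surjective (fun Y : Set ℕ => s '' Y) := hs.image_surjective
  let pt : Set ℕ → Z ⊕ I := fun Y =>
    if (d Y).1 = ∅ then Sum.inl (s (sInf (d Y).2)) else Sum.inr (e (d Y).2)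
  have hpt : Function.Surjective pt := by
    rintro (z | β)
    · obtain ⟨n, rfl⟩ := hs z
      exact ⟨d.symm (∅, {n}), by simp [pt]⟩
    · exact ⟨d.symm (univ, e.symm β), by simp [pt]⟩
  let t : I → (Z ⊕ I) × Set Z × Set Z := fun β =>
    (pt (d (d (e.symm β)).1).1, s '' (d (d (e.symm β)).1).2, s '' (d (d (e.symm β)).2).1)
  -- The unused last coordinate is a free label in `I`: each task occurs with uncountably many
  -- labels, but countably many stages lie below `α`.
  have hsurj (y : (Z ⊕ I) × Set Z × Set Z) (γ : I) :
      ∃ β, t β = y ∧ e (d (d (e.symm β)).2).2 = γ := by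
    obtain ⟨y₁, y₂, y₃⟩ := y
    obtain ⟨a, rfl⟩ := hpt y₁
    obtain ⟨b, rfl⟩ := hpow y₂
    obtain ⟨b', rfl⟩ := hpow y₃
    exact ⟨e (d.symm (d.symm (a, b), d.symm (b', e.symm γ))), by simp [t], by simp⟩
  refine ⟨t, fun y α => ?_⟩
  by_contra! hcon
  refine Set.not_countable_univ (α := I)
    (((hI α).image fun β => e (d (d (e.symm β)).2).2).mono fun γ _ => ?_)
  obtain ⟨β, hβ, hγ⟩ := hsurj y γ
  exact ⟨β, (lt_of_not_ge fun h => hcon β h hβ).le, hγ⟩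

/-- The assertion about an arbitrary decomposition of a space into a countable part and a part
indexed by `ω₁`. -/
theorem exists_topology_of_equiv {X Z I : Type*} [LinearOrder I] [WellFoundedLT I] [Uncountable I]
    [Countable Z] (hI : ∀ α : I, (Iic α).Countable) (e : Set ℕ ≃ I) {i : Z → X} {o : I → X}
    (hi : Function.Injective i) (ho : Function.Injective o) (hio : ∀ z β, i z ≠ o β)
    (hcov : ∀ p, (∃ z, i z = p) ∨ ∃ β, o β = p)
    {P Q : ℕ → Set Z} {M : Set Z} (hp : IsPieces P Q M) :
    ∃ _τ : TopologicalSpace X,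
      IsZeroDimensional X ∧ T2Space X ∧
      (∀ U : Set X, IsOpen U → U.Nonempty → ¬ (U ∩ range o).Countable ∧ (U ∩ i '' M).Infinite ∧
        ∀ᶠ n in atTop, (U ∩ i '' P n).Infinite ∧ (U ∩ i '' Q n).Infinite) ∧
      (∀ Y ∈ smallTraces (fun n => i '' P n), ∃ Y' ⊆ Y, Y'.Infinite ∧ SetConverges Y') ∧
      (∀ Y ∈ ctblInfSubsets (univ : Set X), SetConverges Y →
        (Y \ i '' ⋃ n, P n).Finite ∧ Y ∩ i '' (⋃ n, P n) ∈ smallTraces (fun n => i '' P n)) ∧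
      (∀ Y ∈ smallTraces (fun n => i '' P n) ∪ smallTraces (fun n => i '' Q n),
        (accPts Y).Nonempty ∧ accPts Y ⊆ range o) ∧
      (∀ Y ∈ ctblInfSubsets (i '' M), (accPts Y ∩ range o).Nonempty) ∧
      (∀ n, accPts (i '' P n) = ∅ ∧ accPts (i '' Q n) = ∅) ∧
      (∀ Γ ∈ ctblInfSubsets (range o), accPts Γ = ∅) := by
  classical
  have : Nonempty Z := hp.M_inf.nonempty.to_type
  obtain ⟨t, ht⟩ := exists_cofinal_enumeration (Z := Z) hI e
  -- Inadmissible tasks are replaced by separation from `P 0 ∪ Q 0`, which is always allowed.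
  let A : I → Set Z := fun α =>
    if Separable P Q M (t α).1 (t α).2.1 then (t α).2.1 else P 0 ∪ Q 0
  refine exists_topology hI hi ho hio hcov hp (x := fun α => (t α).1) (A := A)
    (C := fun α => (t α).2.2) (fun α => ?_) (fun y A₀ C₀ hy α => ?_)
  · by_cases h : Separable P Q M (t α).1 (t α).2.1
    · simpa only [A, if_pos h] using h
    · simp only [A, if_neg h]
      exact Or.inl ⟨0, rfl⟩
  · obtain ⟨β, hβ, h⟩ := ht (y, A₀, C₀) α
    refine ⟨β, hβ, congrArg Prod.fst h, ?_, congrArg (fun y => y.2.2) h⟩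
    simp only [A, h, if_pos hy]

/-! ### Specialization to `ω₁` -/

theorem countable_Iic_of_lt_omega_one (α : Iio (ω₁ : Ordinal.{0})) : (Iic α).Countable := by
  have h : (Iic (α : Ordinal.{0})).Countable := by
    rw [← Order.Iio_succ, ← Cardinal.le_aleph0_iff_set_countable, Cardinal.mk_Iio_ordinal,
      Cardinal.lift_le_aleph0, ← Order.lt_succ_iff, Cardinal.succ_aleph0,
      ← Cardinal.lt_omega_iff_card_lt]
    exact (Cardinal.isSuccLimit_omega 1).succ_lt α.2
  exact h.preimage_of_injOn Subtype.val_injective.injOn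

theorem mk_Iio_omega_one : #(Iio (ω₁ : Ordinal.{0})) = ℵ₁ := by
  rw [Cardinal.mk_Iio_ordinal]
  simp

theorem mainTheorem2 (CH : (𝔠 : Cardinal.{0}) = ℵ₁)
    {K : Type u} {L : Type v} {M : Type w} [Countable K] [Countable L] [Countable M] [Infinite M]
    (Kn : ℕ → Set K) (Ln : ℕ → Set L)
    (hK : IsInfinitePartition Kn) (hL : IsInfinitePartition Ln) :
    ∃ τ : TopologicalSpace (Pt K L M),
      IsZeroDimensional (Pt K L M) ∧ T2Space (Pt K L M) ∧
      -- (a)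
      (∀ U : Set (Pt K L M), IsOpen U → U.Nonempty →
        #(U ∩ Pt.partOrd K L M : Set (Pt K L M)) = ℵ₁ ∧
        (U ∩ Pt.partM K L M).Infinite ∧
        ∀ᶠ n in atTop, (U ∩ Pt.inK L M (Kn n)).Infinite ∧ (U ∩ Pt.inL K M (Ln n)).Infinite) ∧
      -- (b)
      (∀ A ∈ smallTraces (fun n => Pt.inK L M (Kn n)),
        ∃ C ⊆ A, C.Infinite ∧ SetConverges C) ∧
      -- (c)
      (∀ A ∈ ctblInfSubsets (univ : Set (Pt K L M)), SetConverges A →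
        (A \ Pt.partK K L M).Finite ∧
        A ∩ Pt.partK K L M ∈ smallTraces (fun n => Pt.inK L M (Kn n))) ∧
      -- (d)
      (∀ B ∈ smallTraces (fun n => Pt.inK L M (Kn n)) ∪ smallTraces (fun n => Pt.inL K M (Ln n)),
        (accPts B).Nonempty ∧ accPts B ⊆ Pt.partOrd K L M) ∧
      -- (e)
      (∀ B ∈ ctblInfSubsets (Pt.partM K L M), (accPts B ∩ Pt.partOrd K L M).Nonempty) ∧
      -- (f)
      (∀ n, accPts (Pt.inK L M (Kn n)) = ∅ ∧ accPts (Pt.inL K M (Ln n)) = ∅) ∧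
      (∀ Γ ∈ ctblInfSubsets (Pt.partOrd K L M), accPts Γ = ∅) := by
  let i : K ⊕ L ⊕ M → Pt K L M := Sum.elim Pt.ofK (Sum.elim Pt.ofL Pt.ofM)
  let P : ℕ → Set (K ⊕ L ⊕ M) := fun n => Sum.inl '' Kn n
  let Q : ℕ → Set (K ⊕ L ⊕ M) := fun n => (Sum.inr ∘ Sum.inl) '' Ln n
  let M' : Set (K ⊕ L ⊕ M) := range (Sum.inr ∘ Sum.inr)
  have hQi : Function.Injective (Sum.inr ∘ Sum.inl : L → K ⊕ L ⊕ M) :=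
    Sum.inr_injective.comp Sum.inl_injective
  have hiP (n : ℕ) : i '' P n = Pt.inK L M (Kn n) := by
    simp only [P, Set.image_image]; rfl
  have hiQ (n : ℕ) : i '' Q n = Pt.inL K M (Ln n) := by
    simp only [Q, Set.image_image]; rfl
  have hiM : i '' M' = Pt.partM K L M := by
    simp only [M', ← Set.range_comp]; rfl
  have hiK : i '' (⋃ n, P n) = Pt.partK K L M := by
    simp only [P, ← Set.image_iUnion, hK.2.2, Set.image_univ, ← Set.range_comp]; rfl
  have hp : IsPieces P Q M' := by
    refine ⟨fun n => (hK.1 n).image Sum.inl_injective.injOn, fun n => (hL.1 n).image hQi.injOn,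
      infinite_range_of_injective (Sum.inr_injective.comp Sum.inr_injective),
      fun m n h => (disjoint_image_iff Sum.inl_injective).2 (hK.2.1 h),
      fun m n h => (disjoint_image_iff hQi).2 (hL.2.1 h), ?_, ?_, ?_⟩
    · simp [P, Q, Set.disjoint_left]
    · simp [P, M', Set.disjoint_left]
    · simp [Q, M', Set.disjoint_left]
  have hcard := mk_Iio_omega_one
  have : Uncountable (Iio (ω₁ : Ordinal.{0})) := by
    rw [← Cardinal.aleph0_lt_mk_iff, hcard]
    exact Cardinal.aleph0_lt_aleph_one
  -- The only use of CH.
  obtain ⟨e⟩ : Nonempty (Set ℕ ≃ Iio (ω₁ : Ordinal.{0})) := by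
    rw [← Cardinal.lift_mk_eq', hcard]
    simp [CH]
  obtain ⟨τ, h0, h1, h2, h3, h4, h5, h6, h7, h8⟩ := exists_topology_of_equiv
    countable_Iic_of_lt_omega_one e (i := i) (o := Pt.ofOrd) (by
      rintro (a | a | a) (b | b | b) h <;> simp_all [i]) (fun a b h => by simpa using h)
    (by rintro (a | a | a) β <;> simp [i])
    (by
      rintro (a | a | a | a)
      exacts [Or.inl ⟨Sum.inl a, rfl⟩, Or.inl ⟨Sum.inr (Sum.inl a), rfl⟩,
        Or.inl ⟨Sum.inr (Sum.inr a), rfl⟩, Or.inr ⟨a, rfl⟩]) hp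
  simp only [hiP, hiQ, hiM, hiK] at h2 h3 h4 h5 h6 h7
  refine ⟨τ, h0, h1, fun U hU hne => ⟨le_antisymm ?_ ?_, (h2 U hU hne).2⟩, h3, h4, h5, h6, h7, h8⟩
  · refine (Cardinal.mk_le_mk_of_subset inter_subset_right).trans ?_
    have := Cardinal.mk_range_le_lift (f := (Pt.ofOrd : _ → Pt K L M))
    rw [hcard] at this
    simpa [Pt.partOrd] using this
  · rw [← Cardinal.succ_aleph0, Order.succ_le_iff, ← not_le, Cardinal.mk_le_aleph0_iff]
    exact (h2 U hU hne).1
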